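/- Let $k$ range over an index set with a limit along which the sample size $n=n_k\to\infty$ and the dimension $d=d_k\to\infty$ (for instance $k\in\mathbb N$, $k\to\infty$, or $k=(n,d)$ with $n,d\to\infty$). For each $k$ let $G_1,\dots,G_{\bar d}$ be a partition of $\{1,\dots,d\}$ into non-empty groups, $g_j=|G_j|$, and for $x\in\mathbb R^d$ let $x(G_j)$ be the sub-vector of $x$ on $G_j$. Put $$\|x\|_{(2,1)}=\sum_{j}\sqrt{g_j}\,\|x(G_j)\|_2,\qquad \|x\|_{(2,\infty)}=\max_{j}\frac{1}{\sqrt{g_j}}\,\|x(G_j)\|_2 .$$ For each $k$ let $\beta^*\in\mathbb R^d$ and let $(X_i,Y_i)$, $1\le i\le n$, satisfy $Y_i=\beta^{*T}X_i+e_i$, where the $X_i\in\mathbb R^d$ are i.i.d. copies of a vector $X$ whose entries have finite second moments, the errors $e_i$ are i.i.d. copies of a real random variable $e$ and are independent of $(X_1,\dots,X_n)$, with $\mathbb E[e]=0$, $\mathbb E[e^2]<\infty$ and $\mathrm{Var}(|e|)>0$. The law of $e$ does not depend on $k$; the law of $X$, the partition and $\beta^*$ may. Let $P_n$ be the empirical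 measure of the $(X_i,Y_i)$, and let $$R_n(\beta)=\inf\{D_c(P,P_n): P \text{ a probability measure on } \mathbb R^d\times\mathbb R,\ \mathbb E_P[X(Y-X^T\beta)]=0\},$$ where $D_c(P,Q)=\inf_\pi \mathbb E_\pi[c(U,W)]$ over all couplings $\pi$ of $P$ and $Q$, with cost $c((x,y),(x',y'))=\|x-x'\|_{(2,\infty)}^2$ if $y=y'$ and $+\infty$ otherwise. Let $\Sigma=\mathrm{Var}(X)$ and $$C(n,d)=\frac{1}{\sqrt n}\,\mathbb E\Big[\max_{j}\sqrt{g_j}\,\|X(G_j)\|_2\Big].$$ **Theorem.** Assume that $\lambda_{\max}(\Sigma)=o\big(n\,C(n,d)^2\big)$ and that $\|\beta^*\|_{(2,1)}=o\big(1/C(n,d)\big)$, i.e. $\|\beta^*\|_{(2,1)}\,C(n,d)\to 0$. Then, as $n,d\to\infty$, $$nR_n(\beta^*)\ \lesssim_D\ \frac{\|Z_n\|_{(2,\infty)}^2}{\mathrm{Var}(|e|)},\qquad Z_n=\frac{1}{\sqrt n}\sum_{i=1}^n e_iX_i,$$ meaning that $nR_n(\beta^*)\le \|Z_n\|_{(2,\infty)}^2/\mathrm{Var}(|e|)+o_p(1)$: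 for every $\varepsilon>0$, the probability that $nR_n(\beta^*)>\|Z_n\|_{(2,\infty)}^2/\mathrm{Var}(|e|)+\varepsilon$ tends to $0$. -/

import Mathlib

open MeasureTheory ProbabilityTheory Filter Topology Asymptotics
open scoped ENNReal

/-- A partition of the coordinates `Fin d` into groups indexed by `Fin m` is given by the map
`G : Fin d → Fin m` sending a coordinate to its group. `groupSize G j` is the cardinality `g_j`
of the `j`-th group. -/
def groupSize {d m : ℕ} (G : Fin d → Fin m) (j : Fin m) : ℕ :=
  (Finset.univ.filter (fun a => G a = j)).card

/-- The Euclidean norm of the sub-vector of `x` on the `j`-th group. -/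
noncomputable def groupL2 {d m : ℕ} (G : Fin d → Fin m) (j : Fin m) (x : Fin d → ℝ) : ℝ :=
  Real.sqrt (∑ a ∈ Finset.univ.filter (fun a => G a = j), x a ^ 2)

/-- The weighted `(2,1)` group norm: the sum of `w_j ‖x(G_j)‖₂` over the groups. -/
noncomputable def groupNormSum {d m : ℕ} (G : Fin d → Fin m) (w : Fin m → ℝ)
    (x : Fin d → ℝ) : ℝ :=
  ∑ j, w j * groupL2 G j x

/-- The weighted `(2,∞)` group norm: the maximum of `w_j ‖x(G_j)‖₂` over the groups. -/
noncomputable def groupNormSup {d m : ℕ} (G : Fin d → Fin m) (w : Fin m → ℝ)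
    (x : Fin d → ℝ) : ℝ :=
  ⨆ j, w j * groupL2 G j x

/-- The weights `α_j = √g_j`. -/
noncomputable def sqrtWeight {d m : ℕ} (G : Fin d → Fin m) (j : Fin m) : ℝ :=
  Real.sqrt (groupSize G j)

/-- The reciprocal weights `1 / √g_j`. -/
noncomputable def invSqrtWeight {d m : ℕ} (G : Fin d → Fin m) (j : Fin m) : ℝ :=
  1 / Real.sqrt (groupSize G j)

/-- The optimal transport discrepancy with cost `c`: the infimum of the expected cost over all
couplings of `P` and `Q`. -/
noncomputable def otDiscrepancy {E : Type*} [MeasurableSpace E] (c : E → E → ℝ≥0∞)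
    (P Q : Measure E) : ℝ≥0∞ :=
  ⨅ (π : Measure (E × E)) (_ : π.map Prod.fst = P ∧ π.map Prod.snd = Q),
    ∫⁻ z, c z.1 z.2 ∂π

open Classical in
/-- The squared `(2,∞)` group norm cost (with weights `1 / √g_j`) on the predictors; moving the
response is forbidden. -/
noncomputable def groupCost {d m : ℕ} (G : Fin d → Fin m)
    (u v : (Fin d → ℝ) × ℝ) : ℝ≥0∞ :=
  if u.2 = v.2 then ENNReal.ofReal (groupNormSup G (invSqrtWeight G) (u.1 - v.1) ^ 2) else ⊤

/-- The empirical measure of the points `z 0, …, z (n - 1)`. -/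
noncomputable def empiricalMeasure {E : Type*} [MeasurableSpace E] {n : ℕ} (z : Fin n → E) :
    Measure E :=
  (n : ℝ≥0∞)⁻¹ • ∑ i, Measure.dirac (z i)

/-- `P` satisfies the estimating equation `E_P[(Y - Xᵀβ) X] = 0` of the square loss. -/
def SatisfiesEstimatingEq {d : ℕ} (β : Fin d → ℝ) (P : Measure ((Fin d → ℝ) × ℝ)) : Prop :=
  Integrable (fun u : (Fin d → ℝ) × ℝ => (u.2 - u.1 ⬝ᵥ β) • u.1) P ∧
    ∫ u, (u.2 - u.1 ⬝ᵥ β) • u.1 ∂P = 0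

/-- The robust Wasserstein profile function of linear regression at `β`, for the reference
measure `Q`: the least discrepancy to `Q` of a probability measure under which `β` satisfies the
estimating equation. -/
noncomputable def rwp {d m : ℕ} (G : Fin d → Fin m) (Q : Measure ((Fin d → ℝ) × ℝ))
    (β : Fin d → ℝ) : ℝ≥0∞ :=
  ⨅ (P : Measure ((Fin d → ℝ) × ℝ)) (_ : IsProbabilityMeasure P ∧ SatisfiesEstimatingEq β P),
    otDiscrepancy (groupCost G) P Q

/-- The covariance matrix of a law on `ℝᵈ`. -/
noncomputable def covMat {d : ℕ} (μ : Measure (Fin d → ℝ)) : Matrix (Fin d) (Fin d) ℝ :=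
  Matrix.of fun a b => covariance (fun x => x a) (fun x => x b) μ

/-- The largest eigenvalue of a (symmetric) real matrix. -/
noncomputable def lambdaMax {d : ℕ} (A : Matrix (Fin d) (Fin d) ℝ) : ℝ :=
  sSup (spectrum ℝ A)

/-- `C(n,d) = E[max_j √g_j ‖X(G_j)‖₂] / √n` for `X` of law `μ`. -/
noncomputable def dimConst {d m : ℕ} (G : Fin d → Fin m) (μ : Measure (Fin d → ℝ)) (n : ℕ) : ℝ :=
  (∫ x, groupNormSup G (sqrtWeight G) x ∂μ) / Real.sqrt n

/-- `Z_n = n^{-1/2} ∑ᵢ eᵢ Xᵢ`. -/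
noncomputable def scoreSum {d n : ℕ} (x : Fin n → Fin d → ℝ) (e : Fin n → ℝ) : Fin d → ℝ :=
  (Real.sqrt n)⁻¹ • ∑ i, e i • x i

/-- Asymptotic stochastic domination `A ≲_D B` along `l`, in the form `A ≤ B + o_p(1)`:
for every `ε > 0` the probability of `A > B + ε` tends to `0`. The random variables may live on
different probability spaces. -/
def AsympStochLE {ι : Type*} {Ω : ι → Type*} [∀ k, MeasurableSpace (Ω k)] (l : Filter ι)
    (P : ∀ k, Measure (Ω k)) (A : ∀ k, Ω k → ℝ≥0∞) (B : ∀ k, Ω k → ℝ) : Prop :=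
  ∀ ε : ℝ, 0 < ε →
    Tendsto (fun k => P k {ω | ENNReal.ofReal (B k ω + ε) < A k ω}) l (𝓝 0)

/-! Since `rwp` is an infimum, one feasible measure gives an upper bound. Regress the predictors on
the errors through the origin: v = ∑ eᵢxᵢ / ∑ eᵢ², and replace xᵢ by xᵢ - eᵢv, keeping yᵢ. The new
points are orthogonal to the errors, while each new residual is the same multiple of eᵢ, so the
estimating equation holds exactly. The transport cost is n⁻¹ ∑ eᵢ² ‖v‖², which gives nRₙ ≤ ‖Zₙ‖² /
(n⁻¹ ∑ eᵢ²) for every sample with ∑ eᵢ² > 0 (`nat_mul_rwp_empiricalMeasure_le`). Moreover Var|e| <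
E[e²] strictly, so by a weak law n⁻¹ ∑ eᵢ² ≥ Var|e| with probability tending to 1
(`tendsto_measure_sum_sq_div_lt`). -/

theorem groupL2_smul {d m : ℕ} (G : Fin d → Fin m) (j : Fin m) (c : ℝ) (x : Fin d → ℝ) :
    groupL2 G j (c • x) = |c| * groupL2 G j x := by
  simp only [groupL2, Pi.smul_apply, smul_eq_mul, mul_pow]
  rw [← Finset.mul_sum, Real.sqrt_mul (sq_nonneg c), Real.sqrt_sq_eq_abs]

theorem groupNormSup_smul {d m : ℕ} (G : Fin d → Fin m) (w : Fin m → ℝ) (c : ℝ)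
    (x : Fin d → ℝ) : groupNormSup G w (c • x) = |c| * groupNormSup G w x := by
  simp only [groupNormSup, groupL2_smul]
  rw [Real.mul_iSup_of_nonneg (abs_nonneg c)]
  exact iSup_congr fun j => by ring

theorem isProbabilityMeasure_empiricalMeasure {E : Type*} [MeasurableSpace E] {n : ℕ}
    (hn : n ≠ 0) (z : Fin n → E) : IsProbabilityMeasure (empiricalMeasure z) := by
  constructor
  simp only [empiricalMeasure, Measure.smul_apply, Measure.finsetSum_apply, measure_univ,
    Finset.sum_const, Finset.card_univ, Fintype.card_fin, smul_eq_mul, nsmul_eq_mul, mul_one]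
  exact ENNReal.inv_mul_cancel (by exact_mod_cast hn) (ENNReal.natCast_ne_top n)

theorem map_empiricalMeasure {E F : Type*} [MeasurableSpace E] [MeasurableSpace F] {n : ℕ}
    {f : E → F} (hf : Measurable f) (z : Fin n → E) :
    (empiricalMeasure z).map f = empiricalMeasure fun i => f (z i) := by
  ext s hs
  rw [Measure.map_apply hf hs]
  simp [empiricalMeasure, Measure.dirac_apply' _ hs, Measure.dirac_apply' _ (hf hs),
    Set.indicator, -Finset.sum_boole]
  rfl

/-- Matching the atoms of two empirical measures bounds the transport discrepancy. -/
theorem otDiscrepancy_empiricalMeasure_le {E : Type*} [MeasurableSpace E]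
    [MeasurableSingletonClass (E × E)] (c : E → E → ℝ≥0∞) {n : ℕ} (z w : Fin n → E) :
    otDiscrepancy c (empiricalMeasure z) (empiricalMeasure w) ≤
      (n : ℝ≥0∞)⁻¹ * ∑ i, c (z i) (w i) := by
  refine (iInf₂_le (empiricalMeasure fun i => (z i, w i))
    ⟨map_empiricalMeasure measurable_fst _, map_empiricalMeasure measurable_snd _⟩).trans ?_
  rw [empiricalMeasure, lintegral_smul_measure, lintegral_finsetSum_measure]
  simp [lintegral_dirac]

theorem integrable_empiricalMeasure {E F : Type*} [MeasurableSpace E] [MeasurableSingletonClass E]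
    [NormedAddCommGroup F] {n : ℕ} (hn : n ≠ 0) (z : Fin n → E) (f : E → F) :
    Integrable f (empiricalMeasure z) := by
  refine Integrable.smul_measure ?_ (by simpa using hn)
  exact integrable_finsetSum_measure.2 fun i _ => integrable_dirac (by simp)

theorem integral_empiricalMeasure {E F : Type*} [MeasurableSpace E] [MeasurableSingletonClass E]
    [NormedAddCommGroup F] [NormedSpace ℝ F] [CompleteSpace F] {n : ℕ} (z : Fin n → E)
    (f : E → F) : ∫ u, f u ∂empiricalMeasure z = (n : ℝ)⁻¹ • ∑ i, f (z i) := by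
  rw [empiricalMeasure, integral_smul_measure,
    integral_finsetSum_measure fun i _ => integrable_dirac (by simp)]
  simp

theorem satisfiesEstimatingEq_empiricalMeasure {d n : ℕ} (hn : n ≠ 0) (β : Fin d → ℝ)
    (z : Fin n → (Fin d → ℝ) × ℝ) (h : ∑ i, ((z i).2 - (z i).1 ⬝ᵥ β) • (z i).1 = 0) :
    SatisfiesEstimatingEq β (empiricalMeasure z) := by
  refine ⟨integrable_empiricalMeasure hn _ _, ?_⟩
  rw [integral_empiricalMeasure, h, smul_zero]

/-- Moving each `x i` by a multiple of `e i • scoreSum x e` solves the estimating equation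
exactly. -/
theorem sum_residual_smul_eq_zero {d n : ℕ} (hn : n ≠ 0) (β : Fin d → ℝ) (x : Fin n → Fin d → ℝ)
    (e : Fin n → ℝ) (hS : ∑ i, e i ^ 2 ≠ 0) (v : Fin d → ℝ)
    (hv : v = (Real.sqrt n / ∑ i, e i ^ 2) • scoreSum x e) :
    ∑ i, (β ⬝ᵥ x i + e i - (x i - e i • v) ⬝ᵥ β) • (x i - e i • v) = 0 := by
  -- The factor 1 + v·β does not depend on i, so it comes out of the sum and the quadratic equation
  -- becomes linear in v.
  have hr : ∀ i, β ⬝ᵥ x i + e i - (x i - e i • v) ⬝ᵥ β = (1 + v ⬝ᵥ β) * e i := by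
    intro i
    rw [sub_dotProduct, smul_dotProduct, dotProduct_comm β, smul_eq_mul]
    ring
  have hn' : Real.sqrt n ≠ 0 := by positivity
  have hx : ∑ i, e i • x i = (∑ i, e i ^ 2) • v := by
    rw [hv, scoreSum, smul_smul, smul_smul, mul_div_cancel₀ _ hS, mul_inv_cancel₀ hn', one_smul]
  simp only [hr, mul_smul, ← Finset.smul_sum, smul_sub, Finset.sum_sub_distrib, hx]
  rw [Finset.sum_smul]
  simp only [pow_two, mul_smul, sub_self]

/-- Nonasymptotic bound: `n R_n(β) ≤ ‖Z_n‖² / (n⁻¹ ∑ eᵢ²)`. -/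
theorem nat_mul_rwp_empiricalMeasure_le {d m n : ℕ} (G : Fin d → Fin m) (hn : n ≠ 0)
    (β : Fin d → ℝ) (x : Fin n → Fin d → ℝ) (e : Fin n → ℝ) (hS : 0 < ∑ i, e i ^ 2) :
    (n : ℝ≥0∞) * rwp G (empiricalMeasure fun i => (x i, β ⬝ᵥ x i + e i)) β ≤
      ENNReal.ofReal (groupNormSup G (invSqrtWeight G) (scoreSum x e) ^ 2 /
        ((∑ i, e i ^ 2) / n)) := by
  set v := (Real.sqrt n / ∑ i, e i ^ 2) • scoreSum x e with hv
  have hle := (iInf₂_le (f := fun (P : Measure ((Fin d → ℝ) × ℝ))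
      (_ : IsProbabilityMeasure P ∧ SatisfiesEstimatingEq β P) =>
        otDiscrepancy (groupCost G) P (empiricalMeasure fun i => (x i, β ⬝ᵥ x i + e i)))
    (empiricalMeasure fun i => (x i - e i • v, β ⬝ᵥ x i + e i))
    ⟨isProbabilityMeasure_empiricalMeasure hn _, satisfiesEstimatingEq_empiricalMeasure hn _ _
      (sum_residual_smul_eq_zero hn β x e hS.ne' v hv)⟩).trans
    (otDiscrepancy_empiricalMeasure_le _ _ _)
  refine (mul_le_mul_right hle _).trans ?_
  rw [← mul_assoc, ENNReal.mul_inv_cancel (by exact_mod_cast hn) (ENNReal.natCast_ne_top n),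
    one_mul]
  -- Responses stay fixed, so the cost is on its finite branch.
  have hc : ∀ i, groupCost G (x i - e i • v, β ⬝ᵥ x i + e i) (x i, β ⬝ᵥ x i + e i) =
      ENNReal.ofReal (e i ^ 2 * ((√n / ∑ i, e i ^ 2) ^ 2 *
        groupNormSup G (invSqrtWeight G) (scoreSum x e) ^ 2)) := by
    intro i
    rw [groupCost, if_pos rfl]
    congr 1
    rw [show x i - e i • v - x i = (-e i * (√n / ∑ i, e i ^ 2)) • scoreSum x e by
      rw [mul_smul, ← hv, neg_smul]; abel]
    rw [groupNormSup_smul, mul_pow, sq_abs]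
    ring
  simp only [hc]
  rw [← ENNReal.ofReal_sum_of_nonneg fun i _ => by positivity, ← Finset.sum_mul]
  refine le_of_eq (congrArg _ ?_)
  have hn' : (n : ℝ) ≠ 0 := by exact_mod_cast hn
  rw [div_pow, Real.sq_sqrt (Nat.cast_nonneg n)]
  field_simp

/-- The gap is (E|e|)², which vanishes only if e = 0 almost surely; that would make Var|e| zero. -/
theorem variance_abs_lt_integral_sq (ν : Measure ℝ) [IsProbabilityMeasure ν]
    (hν : MemLp (fun t : ℝ => t) 2 ν) (hpos : 0 < variance (fun t : ℝ => |t|) ν) :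
    variance (fun t : ℝ => |t|) ν < ∫ t, t ^ 2 ∂ν := by
  have habs : MemLp (fun t : ℝ => |t|) 2 ν := hν.norm
  have hint : 0 < ∫ t, |t| ∂ν := by
    refine lt_of_le_of_ne (integral_nonneg fun t => abs_nonneg t) fun h0 => hpos.ne' ?_
    have hz := (integral_eq_zero_iff_of_nonneg (fun t => abs_nonneg t)
      (habs.integrable one_le_two)).1 h0.symm
    rw [variance_congr hz]
    exact variance_zero ν
  rw [variance_eq_sub habs]
  have : ν[(fun t : ℝ => |t|) ^ 2] = ∫ t, t ^ 2 ∂ν := by simp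
  rw [this]
  have := pow_pos hint 2
  linarith

/-- Truncation makes Chebyshev available for e², whose own variance may be infinite. -/
theorem exists_lt_integral_min (ν : Measure ℝ) [IsProbabilityMeasure ν]
    (hν : MemLp (fun t : ℝ => t) 2 ν) {v : ℝ} (hv : v < ∫ t, t ^ 2 ∂ν) :
    ∃ M : ℕ, v < ∫ t, min (t ^ 2) (M : ℝ) ∂ν := by
  have h : Tendsto (fun M : ℕ => ∫ t, min (t ^ 2) (M : ℝ) ∂ν) atTop (𝓝 (∫ t, t ^ 2 ∂ν)) := by
    refine tendsto_integral_of_dominated_convergence (fun t => t ^ 2)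
      (fun M => (by fun_prop : Measurable fun t : ℝ => min (t ^ 2) (M : ℝ)).aestronglyMeasurable)
      hν.integrable_sq (fun M => ae_of_all _ fun t => ?_) (ae_of_all _ fun t => ?_)
    · rw [Real.norm_of_nonneg (by positivity)]
      exact min_le_left _ _
    · obtain ⟨N, hN⟩ := exists_nat_ge (t ^ 2)
      refine tendsto_const_nhds.congr' ?_
      filter_upwards [eventually_ge_atTop N] with M hM
      rw [min_eq_left (hN.trans (by exact_mod_cast hM))]
  exact (h.eventually (lt_mem_nhds hv)).exists

/-- One-sided Chebyshev bound for the average of i.i.d. square-integrable transforms. -/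
theorem measure_sum_div_lt_le {Ω : Type*} [MeasurableSpace Ω] (P : Measure Ω)
    [IsProbabilityMeasure P] (ν : Measure ℝ) {n : ℕ} (hn : n ≠ 0) (e : Fin n → Ω → ℝ)
    (hlaw : ∀ i, HasLaw (e i) ν P) (hindep : iIndepFun e P) (f : ℝ → ℝ) (hf : Measurable f)
    (hf2 : MemLp f 2 ν) {v : ℝ} (hv : v < ∫ t, f t ∂ν) :
    P {ω | (∑ i, f (e i ω)) / n < v} ≤
      ENNReal.ofReal (variance f ν / (∫ t, f t ∂ν - v) ^ 2 / n) := by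
  have hn' : (0 : ℝ) < n := by positivity
  have hmem : ∀ i, MemLp (fun ω => f (e i ω)) 2 P := fun i => by
    have h := hf2
    rw [← (hlaw i).map_eq] at h
    exact h.comp_of_map (hlaw i).aemeasurable
  have hmean : ∀ i, ∫ ω, f (e i ω) ∂P = ∫ t, f t ∂ν := fun i =>
    (hlaw i).integral_comp hf.aestronglyMeasurable
  have hvar : ∀ i, variance (fun ω => f (e i ω)) P = variance f ν := fun i => by
    rw [← (hlaw i).map_eq, variance_map hf.aemeasurable (hlaw i).aemeasurable]
    rfl
  have hsum : variance (fun ω => ∑ i, f (e i ω)) P = n * variance f ν := by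
    have h := IndepFun.variance_sum (s := Finset.univ) (fun i _ => hmem i)
      (fun i _ j _ hij => (hindep.indepFun hij).comp hf hf)
    rw [show (fun ω => ∑ i, f (e i ω)) = ∑ i, fun ω => f (e i ω) by ext; simp, h]
    simp [hvar]
  have hmean' : ∫ ω, ∑ i, f (e i ω) ∂P = n * ∫ t, f t ∂ν := by
    rw [integral_finsetSum _ fun i _ => (hmem i).integrable one_le_two]
    simp [hmean]
  have hδ : 0 < ∫ t, f t ∂ν - v := sub_pos.2 hv
  have hcheb := meas_ge_le_variance_div_sq
    (memLp_finsetSum Finset.univ fun i _ => hmem i) (mul_pos hn' hδ)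
  rw [hsum, hmean'] at hcheb
  refine (measure_mono fun ω hω => ?_).trans (hcheb.trans (le_of_eq (congrArg _ ?_)))
  · simp only [Set.mem_ofPred_eq, div_lt_iff₀ hn'] at hω ⊢
    rw [abs_sub_comm]
    refine le_trans ?_ (le_abs_self _)
    linarith
  · field_simp

/-- Lower half of the weak law of large numbers for the mean of the squared errors, for triangular
arrays with a fixed law. -/
theorem tendsto_measure_sum_sq_div_lt {ι : Type*} {l : Filter ι} {n : ι → ℕ}
    (hn : Tendsto n l atTop) (ν : Measure ℝ) [IsProbabilityMeasure ν]
    (hν : MemLp (fun t : ℝ => t) 2 ν) {Ω : ι → Type*} [∀ k, MeasurableSpace (Ω k)]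
    (P : ∀ k, Measure (Ω k)) [∀ k, IsProbabilityMeasure (P k)] (e : ∀ k, Fin (n k) → Ω k → ℝ)
    (hlaw : ∀ k i, HasLaw (e k i) ν (P k)) (hindep : ∀ k, iIndepFun (e k) (P k)) {v : ℝ}
    (hv : v < ∫ t, t ^ 2 ∂ν) :
    Tendsto (fun k => P k {ω | (∑ i, e k i ω ^ 2) / n k < v}) l (𝓝 0) := by
  obtain ⟨M, hM⟩ := exists_lt_integral_min ν hν hv
  have hf : Measurable fun t : ℝ => min (t ^ 2) (M : ℝ) := by fun_prop
  have hf2 : MemLp (fun t : ℝ => min (t ^ 2) (M : ℝ)) 2 ν :=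
    MemLp.of_bound hf.aestronglyMeasurable M (ae_of_all _ fun t => by
      rw [Real.norm_of_nonneg (by positivity)]
      exact min_le_right _ _)
  have hlim := ENNReal.tendsto_ofReal ((tendsto_const_div_atTop_nhds_zero_nat
    (variance (fun t : ℝ => min (t ^ 2) (M : ℝ)) ν /
      (∫ t, min (t ^ 2) (M : ℝ) ∂ν - v) ^ 2)).comp hn)
  rw [ENNReal.ofReal_zero] at hlim
  refine tendsto_of_tendsto_of_tendsto_of_le_of_le' tendsto_const_nhds hlim
    (Eventually.of_forall fun k => zero_le) ?_
  filter_upwards [hn.eventually_ne_atTop 0] with k hk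
  -- Truncating only lowers the average, so the lower-tail event can only grow.
  refine (measure_mono fun ω hω => ?_).trans
    (measure_sum_div_lt_le (P k) ν hk (e k) (hlaw k) (hindep k) _ hf hf2 hM)
  simp only [Set.mem_ofPred_eq] at hω ⊢
  refine lt_of_le_of_lt ?_ hω
  gcongr
  exact min_le_left _ _

theorem mainTheorem6
    {ι : Type*} (l : Filter ι)
    -- sample sizes, dimensions, numbers of groups and partitions into non-empty groups
    (n d m : ι → ℕ) (hn : Tendsto n l atTop) (hd : Tendsto d l atTop)
    (G : ∀ k, Fin (d k) → Fin (m k)) (hG : ∀ k, Function.Surjective (G k))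
    -- law of the predictors, with finite second moments
    (μ : ∀ k, Measure (Fin (d k) → ℝ)) [∀ k, IsProbabilityMeasure (μ k)]
    (hμ : ∀ k a, MemLp (fun x : Fin (d k) → ℝ => x a) 2 (μ k))
    -- law of the errors: mean zero, finite second moment, and positive variance of `|e|`
    (ν : Measure ℝ) [IsProbabilityMeasure ν] (hν : MemLp (fun t : ℝ => t) 2 ν)
    (hν0 : ∫ t, t ∂ν = 0) (hνvar : 0 < variance (fun t : ℝ => |t|) ν)
    -- true regression parameters
    (β : ∀ k, Fin (d k) → ℝ)
    -- i.i.d. predictors and i.i.d. errors, independent of the predictors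
    {Ω : ι → Type*} [∀ k, MeasurableSpace (Ω k)]
    (P : ∀ k, Measure (Ω k)) [∀ k, IsProbabilityMeasure (P k)]
    (X : ∀ k, Fin (n k) → Ω k → Fin (d k) → ℝ) (e : ∀ k, Fin (n k) → Ω k → ℝ)
    (hXlaw : ∀ k i, HasLaw (X k i) (μ k) (P k)) (helaw : ∀ k i, HasLaw (e k i) ν (P k))
    (hXindep : ∀ k, iIndepFun (X k) (P k)) (heindep : ∀ k, iIndepFun (e k) (P k))
    (hXe : ∀ k, IndepFun (fun ω i => X k i ω) (fun ω i => e k i ω) (P k))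
    -- the linear model
    (Y : ∀ k, Fin (n k) → Ω k → ℝ) (hY : ∀ k i ω, Y k i ω = β k ⬝ᵥ X k i ω + e k i ω)
    -- largest eigenvalue condition
    (hlam : (fun k => lambdaMax (covMat (μ k))) =o[l]
      fun k => (n k : ℝ) * dimConst (G k) (μ k) (n k) ^ 2)
    -- weak sparsity: the norm of `β` is `o(1 / C(n,d))`
    (hβ : Tendsto (fun k => groupNormSum (G k) (sqrtWeight (G k)) (β k) *
      dimConst (G k) (μ k) (n k)) l (𝓝 0)) :
    AsympStochLE l P
      (fun k ω => (n k : ℝ≥0∞) *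
        rwp (G k) (empiricalMeasure fun i => (X k i ω, Y k i ω)) (β k))
      (fun k ω => groupNormSup (G k) (invSqrtWeight (G k))
          (scoreSum (fun i => X k i ω) (fun i => e k i ω)) ^ 2 /
        variance (fun t : ℝ => |t|) ν) := by
  intro ε hε
  have hlt := variance_abs_lt_integral_sq ν hν hνvar
  refine tendsto_of_tendsto_of_tendsto_of_le_of_le' tendsto_const_nhds
    (tendsto_measure_sum_sq_div_lt hn ν hν P e helaw heindep hlt)
    (Eventually.of_forall fun k => zero_le) ?_
  filter_upwards [hn.eventually_ne_atTop 0] with k hk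
  refine measure_mono fun ω hω => ?_
  simp only [Set.mem_ofPred_eq] at hω ⊢
  -- Outside the event n⁻¹ ∑ eᵢ² < Var|e|, the deterministic bound already gives the claim.
  by_contra! hle
  have hn' : (0 : ℝ) < n k := by positivity
  have hS : 0 < ∑ i, e k i ω ^ 2 := (div_pos_iff_of_pos_right hn').1 (hνvar.trans_le hle)
  refine hω.not_ge ?_
  simp only [hY]
  refine (nat_mul_rwp_empiricalMeasure_le (G k) hk (β k) (fun i => X k i ω)
    (fun i => e k i ω) hS).trans (ENNReal.ofReal_le_ofReal ?_)
  -- The slack ε is not needed: the strict gap Var|e| < E[e²] absorbs the fluctuations.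
  refine le_trans ?_ (le_add_of_nonneg_right hε.le)
  gcongr
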